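/- Let $G$ be a countable amenable group, where amenable means that for every $\varepsilon>0$ and every finite $K\subseteq G$ there is a finite $H\subseteq G$ such that fewer than $\varepsilon|H|$ elements $g\in G$ have the property that $Kg$ meets both $H$ and $G\setminus H$. Let $1\le p<\infty$. An $L_p$ lattice is a real Banach lattice $E$ isometrically lattice isomorphic to $L^p(X,\mathcal F,\mu)$ for some measure space $(X,\mathcal F,\mu)$, and a $G$-$L_p$ lattice is an $L_p$ lattice $E$ together with a homomorphism from $G$ to the group of Banach-lattice automorphisms of $E$ (linear isometric bijections preserving the lattice operations); we write $gv$ for the image of $v$ under the automorphism given by $g$. Elements $x,y\in E$ are disjoint if $|x|\wedge|y|=0$; for $A\subseteq E$, $A^\perp$ denotes the set of elements disjoint from every element of $A$; and $\mathfrak b(u)=(\{u\}^{\perp})^{\perp}$ is the band generated by $u$. Put $E_+=\{u\in E: u\ge 0\}$. The $G$-$L_p$ lattice $E$ is functionally free if for every $g\in G\setminus\{1_G\}$ and every $u\in E$ with $u>0$ (that is, $u\geq 0$ and $u\neq 0$) there is $v\in\mathfrak b(u)$ with $v>0$ such that $v$ and $gv$ are disjoint. Then $E$ is functionally free if and only if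 for every $g\in G\setminus\{1_G\}$, every $u\in E_+$ and every $\varepsilon>0$ there exist $v,w\in E_+$ such that 1. $v\le u+w$ and $\|w\|\le\varepsilon$, 2. $\|v\wedge gv\|\le\varepsilon$, 3. $\|v\|\ge\frac13\|u\|-\varepsilon$. Moreover, functional freeness is axiomatised, among $G$-$L_p$ lattices, by sentences of the continuous language of Banach lattices expanded by unary function symbols for the elements of $G$: $E$ is functionally free if and only if, for every $g\in G\setminus\{1_G\}$, $$\sup_{x}\ \inf_{y}\ \max\Bigl(\bigl\|(|x|-|y|)^-\bigr\|,\ \bigl\|g|y|\wedge|y|\bigr\|,\ \tfrac13\|x\|-\|y\|\Bigr)=0,$$ where $x$ and $y$ range over the closed unit ball of $E$ and $a^-=(-a)\vee 0$. -/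

import Mathlib

open MeasureTheory
open scoped ENNReal

universe w u v

noncomputable section

namespace GLp

/-- The `K`-boundary of a subset `H` of a group: the set of those `g` such that `K g` contains
points both in `H` and outside `H`. -/
def boundary {G : Type*} [Group G] (K H : Set G) : Set G :=
  {g | (∃ k ∈ K, k * g ∈ H) ∧ (∃ k ∈ K, k * g ∉ H)}

/-- Amenability of a discrete group, in Følner's form: for every `ε > 0` and every finite `K`
there is a finite set `H` whose `K`-boundary has fewer than `ε |H|` points. The boundary of a
finite set with respect to a finite set is finite, so `Set.ncard` is its true cardinality. -/
def IsAmenable (G : Type*) [Group G] : Prop :=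
  ∀ ε : ℝ, 0 < ε → ∀ K : Finset G, ∃ H : Finset G,
    ((boundary (K : Set G) (H : Set G)).ncard : ℝ) < ε * (H.card : ℝ)

/-- `E` is an `L_p` lattice: it is isometrically and order isomorphic to the real Banach lattice
`L^p(X, μ)` of some measure space, with the almost everywhere pointwise order. -/
def IsLpLattice (p : ℝ≥0∞) [Fact (1 ≤ p)] (E : Type u)
    [NormedAddCommGroup E] [NormedSpace ℝ E] [Lattice E] : Prop :=
  ∃ (X : Type w) (_ : MeasurableSpace X) (μ : Measure X) (Φ : E ≃ₗᵢ[ℝ] Lp ℝ p μ),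
    ∀ x y : E, Φ x ≤ Φ y ↔ x ≤ y

/-- The group of Banach lattice automorphisms of `E`: the linear isometric bijections of `E`
onto itself that preserve the lattice operations. -/
def latticeAut (E : Type*) [NormedAddCommGroup E] [NormedSpace ℝ E] [Lattice E] :
    Subgroup (E ≃ₗᵢ[ℝ] E) where
  carrier := {T | ∀ x y : E, T (x ⊔ y) = T x ⊔ T y ∧ T (x ⊓ y) = T x ⊓ T y}
  mul_mem' := by
    intro S T hS hT x y
    change S (T (x ⊔ y)) = S (T x) ⊔ S (T y) ∧ S (T (x ⊓ y)) = S (T x) ⊓ S (T y)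
    exact ⟨by rw [(hT x y).1, (hS _ _).1], by rw [(hT x y).2, (hS _ _).2]⟩
  one_mem' := fun _ _ => ⟨rfl, rfl⟩
  inv_mem' := by
    intro T hT x y
    have key : ∀ z : E, T (T⁻¹ z) = z := fun z => T.apply_symm_apply z
    constructor
    · apply T.injective
      rw [(hT _ _).1, key, key, key]
    · apply T.injective
      rw [(hT _ _).2, key, key, key]

section Lattice

variable {E : Type*} [NormedAddCommGroup E] [NormedSpace ℝ E] [Lattice E]

/-- Two elements of a vector lattice are disjoint if `|x| ⊓ |y| = 0`. -/
def AreDisjoint (x y : E) : Prop := |x| ⊓ |y| = 0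

/-- The disjoint complement of a set. -/
def disjointComplement (A : Set E) : Set E := {x | ∀ y ∈ A, AreDisjoint x y}

/-- The band generated by an element: the double disjoint complement of `{u}`. -/
def band (u : E) : Set E := disjointComplement (disjointComplement {u})

/-- Functional freeness of an action of `G` on `E` by Banach lattice automorphisms: for every
`g ≠ 1`, the band generated by any (nonzero) positive element contains a (nonzero) positive
element that is disjoint from its image under `g`. -/
def FunctionallyFree {G : Type*} [Group G] (ρ : G →* latticeAut E) : Prop :=
  ∀ g : G, g ≠ 1 → ∀ u : E, 0 < u →
    ∃ v ∈ band u, 0 < v ∧ AreDisjoint v ((ρ g : E ≃ₗᵢ[ℝ] E) v)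

/-- The value in `E` of the sentence
`sup_x inf_y max (‖(|x| - |y|)⁻‖, ‖g|y| ⊓ |y|‖, ‖x‖ / 3 - ‖y‖)` of the continuous language of
Banach lattices with an action of `G`, where both variables range over the closed unit ball. -/
def freenessSentence {G : Type*} [Group G] (ρ : G →* latticeAut E) (g : G) : ℝ :=
  ⨆ x : Metric.closedBall (0 : E) 1, ⨅ y : Metric.closedBall (0 : E) 1,
    max (max ‖(|(x : E)| - |(y : E)|)⁻‖ ‖(ρ g : E ≃ₗᵢ[ℝ] E) |(y : E)| ⊓ |(y : E)|‖)
      (‖(x : E)‖ / 3 - ‖(y : E)‖)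

end Lattice

end GLp

end

set_option linter.unusedSectionVars false

namespace GLp

/-! ### Disjointness and order ideals in vector lattices -/

section VectorLattice

variable {E : Type*} [AddCommGroup E] [Lattice E] [IsOrderedAddMonoid E]

/-! Each `g` is treated separately, as a lattice automorphism `T`. From the `L^p` structure the
argument takes completeness, the solid norm and superadditivity of `‖·‖ ^ p` on the positive cone,
which supplies band projections and strict monotonicity of the norm.

Forward (`exists_disjoint_third`): take a maximal solid cone `S` disjoint from `T S`. If `z > 0`
were disjoint from `S`, `T S` and `T⁻¹ S`, freeness would give `v > 0` in its band with `v` disjoint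
from `T v`; maximality puts `v` in `S`, though `v` is disjoint from `S`. So the three cones together
generate everything, `u` is nearly dominated by a sum of one element from each, and one of the three
pieces carries a third of the norm.

Converse (`exists_disjoint_of_approx`): if no nonzero `v ≤ u` is disjoint from `T v`, then `v ≤ T v`
on `[0, u]` (`le_map_of_no_disjoint`). An approximate witness `v` then satisfies `v ⊓ u ≤ v ⊓ T v`,
which is small, while `v` is nearly below `u`; so `v` itself is small, contradicting the third. -/

lemma le_inf_add_inf {t a b : E} (ht : 0 ≤ t) (ha : 0 ≤ a) (hb : 0 ≤ b) (h : t ≤ a + b) :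
    t ≤ t ⊓ a + t ⊓ b := by
  rw [add_inf, inf_add, inf_add]
  exact le_inf (le_inf (le_add_of_nonneg_left ht) (le_add_of_nonneg_left ha))
    (le_inf (le_add_of_nonneg_right hb) h)

lemma inf_add_le_inf_add_inf {t a b : E} (ht : 0 ≤ t) (ha : 0 ≤ a) (hb : 0 ≤ b) :
    t ⊓ (a + b) ≤ t ⊓ a + t ⊓ b := by
  refine (le_inf_add_inf (le_inf ht (add_nonneg ha hb)) ha hb inf_le_right).trans ?_
  gcongr <;> exact inf_le_left

lemma inf_eq_zero_of_le {a b a' b' : E} (ha : 0 ≤ a) (hb : 0 ≤ b) (haa : a ≤ a') (hbb : b ≤ b')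
    (h : a' ⊓ b' = 0) : a ⊓ b = 0 :=
  le_antisymm ((inf_le_inf haa hbb).trans h.le) (le_inf ha hb)

lemma inf_add_eq_zero {t a b : E} (ht : 0 ≤ t) (ha : 0 ≤ a) (hb : 0 ≤ b) (hta : t ⊓ a = 0)
    (htb : t ⊓ b = 0) : t ⊓ (a + b) = 0 :=
  le_antisymm ((inf_add_le_inf_add_inf ht ha hb).trans (by rw [hta, htb, add_zero]))
    (le_inf ht (add_nonneg ha hb))

lemma inf_nsmul_eq_zero {t a : E} (ht : 0 ≤ t) (ha : 0 ≤ a) (hta : t ⊓ a = 0) (n : ℕ) :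
    t ⊓ n • a = 0 := by
  induction n with
  | zero => rw [zero_nsmul]; exact inf_eq_right.2 ht
  | succ k ih => rw [succ_nsmul]; exact inf_add_eq_zero ht (nsmul_nonneg ha k) ha ih hta

/-- The positive cone of an order ideal. -/
structure IsSolidCone (S : Set E) : Prop where
  zero_mem : 0 ∈ S
  nonneg : ∀ s ∈ S, 0 ≤ s
  add_mem : ∀ s ∈ S, ∀ t ∈ S, s + t ∈ S
  mem_of_le : ∀ s ∈ S, ∀ t, 0 ≤ t → t ≤ s → t ∈ S

lemma IsSolidCone.sup_mem {S : Set E} (hS : IsSolidCone S) {s t : E} (hs : s ∈ S) (ht : t ∈ S) :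
    s ⊔ t ∈ S :=
  hS.mem_of_le _ (hS.add_mem s hs t ht) _ ((hS.nonneg s hs).trans le_sup_left)
    (sup_le (le_add_of_nonneg_right (hS.nonneg t ht)) (le_add_of_nonneg_left (hS.nonneg s hs)))

lemma IsSolidCone.nsmul_mem {S : Set E} (hS : IsSolidCone S) {s : E} (hs : s ∈ S) (n : ℕ) :
    n • s ∈ S := by
  induction n with
  | zero => rw [zero_nsmul]; exact hS.zero_mem
  | succ k ih => rw [succ_nsmul]; exact hS.add_mem _ ih _ hs

/-- Used with `z = (v - T v)⁺`, to isolate the part of `v` where `v` exceeds `T v`. -/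
lemma isSolidCone_principal (z : E) :
    IsSolidCone {s : E | 0 ≤ s ∧ ∃ n : ℕ, s ≤ n • z} where
  zero_mem := ⟨le_rfl, 0, by simp⟩
  nonneg _ hs := hs.1
  add_mem := by
    rintro s ⟨hs, m, hm⟩ t ⟨ht, n, hn⟩
    exact ⟨add_nonneg hs ht, m + n, by rw [add_nsmul]; exact add_le_add hm hn⟩
  mem_of_le := by
    rintro s ⟨hs, m, hm⟩ t ht hts
    exact ⟨ht, m, hts.trans hm⟩

/-- Serves to combine `S`, `T⁻¹ S` and `T S` into one cone. -/
lemma isSolidCone_add_three {A B C : Set E} (hA : IsSolidCone A) (hB : IsSolidCone B)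
    (hC : IsSolidCone C) :
    IsSolidCone {s : E | 0 ≤ s ∧ ∃ a ∈ A, ∃ b ∈ B, ∃ c ∈ C, s ≤ a + b + c} where
  zero_mem := ⟨le_rfl, 0, hA.zero_mem, 0, hB.zero_mem, 0, hC.zero_mem, by simp⟩
  nonneg _ hs := hs.1
  add_mem := by
    rintro s ⟨hs, a, ha, b, hb, c, hc, h⟩ t ⟨ht, a', ha', b', hb', c', hc', h'⟩
    refine ⟨add_nonneg hs ht, a + a', hA.add_mem _ ha _ ha', b + b', hB.add_mem _ hb _ hb',
      c + c', hC.add_mem _ hc _ hc', (add_le_add h h').trans_eq (by abel)⟩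
  mem_of_le := by
    rintro s ⟨hs, a, ha, b, hb, c, hc, h⟩ t ht hts
    exact ⟨ht, a, ha, b, hb, c, hc, hts.trans h⟩

end VectorLattice

/-! ### Band projections from a superadditive norm -/

section SuperadditiveNorm

variable {E : Type*} [NormedAddCommGroup E] [Lattice E] [IsOrderedAddMonoid E] [HasSolidNorm E]

lemma norm_le_norm_of_nonneg {a b : E} (ha : 0 ≤ a) (hab : a ≤ b) : ‖a‖ ≤ ‖b‖ :=
  norm_le_norm_of_abs_le_abs (by rwa [abs_of_nonneg ha, abs_of_nonneg (ha.trans hab)])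

/-- The `q`-th power of the norm is superadditive on the positive cone. -/
def NormSuperadditive (E : Type*) [NormedAddCommGroup E] [Lattice E] (q : ℝ) : Prop :=
  ∀ a b : E, 0 ≤ a → 0 ≤ b → ‖a‖ ^ q + ‖b‖ ^ q ≤ ‖a + b‖ ^ q

variable {q : ℝ}

/-- Superadditivity for `b = (b - a) + a`: comparable elements of nearly equal norm are close. -/
lemma NormSuperadditive.norm_sub_rpow_le (hs : NormSuperadditive E q) {a b : E} (ha : 0 ≤ a)
    (hab : a ≤ b) : ‖b - a‖ ^ q ≤ ‖b‖ ^ q - ‖a‖ ^ q := by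
  have := hs (b - a) a (sub_nonneg.2 hab) ha
  rw [sub_add_cancel] at this
  linarith

lemma NormSuperadditive.eq_of_le_of_norm_eq (hs : NormSuperadditive E q) (hq : 0 < q) {a b : E}
    (ha : 0 ≤ a) (hab : a ≤ b) (h : ‖a‖ = ‖b‖) : a = b := by
  have h1 := hs.norm_sub_rpow_le ha hab
  rw [h, sub_self] at h1
  have h2 := (Real.rpow_eq_zero (norm_nonneg (b - a)) hq.ne').1
    (le_antisymm h1 (Real.rpow_nonneg (norm_nonneg _) _))
  exact (sub_eq_zero.1 (norm_eq_zero.1 h2)).symm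

variable [CompleteSpace E]

/-- A nonempty sup-closed set of positive elements that is bounded above has an upper bound in
its norm closure. -/
lemma NormSuperadditive.exists_upperBound_mem_closure (hs : NormSuperadditive E q) (hq : 0 < q)
    {D : Set E} (hne : D.Nonempty) (hsup : ∀ a ∈ D, ∀ b ∈ D, a ⊔ b ∈ D) {u : E}
    (hD : ∀ d ∈ D, 0 ≤ d ∧ d ≤ u) : ∃ x ∈ closure D, ∀ d ∈ D, d ≤ x := by
  set c := sSup ((fun d : E => ‖d‖ ^ q) '' D) with hc
  have hbdd : BddAbove ((fun d : E => ‖d‖ ^ q) '' D) := by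
    refine ⟨‖u‖ ^ q, ?_⟩
    rintro _ ⟨d, hd, rfl⟩
    exact Real.rpow_le_rpow (norm_nonneg _)
      (norm_le_norm_of_nonneg (hD d hd).1 (hD d hd).2) hq.le
  have hle : ∀ d ∈ D, ‖d‖ ^ q ≤ c := fun d hd => le_csSup hbdd ⟨d, hd, rfl⟩
  have happ : ∀ n : ℕ, ∃ d ∈ D, c - 1 / ((n : ℝ) + 1) < ‖d‖ ^ q := by
    intro n
    have hpos : (0 : ℝ) < 1 / ((n : ℝ) + 1) := by positivity
    obtain ⟨_, ⟨d, hd, rfl⟩, h⟩ :=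
      exists_lt_of_lt_csSup (hne.image _) (show c - 1 / ((n : ℝ) + 1) < c by linarith)
    exact ⟨d, hd, h⟩
  choose d hd hdc using happ
  -- Partial suprema make the norm-maximising sequence increasing without leaving `D`.
  have he : ∀ n, partialSups d n ∈ D := by
    intro n
    induction n with
    | zero => simpa using hd 0
    | succ k ih => rw [partialSups_add_one]; exact hsup _ ih _ (hd _)
  set b : ℕ → ℝ := fun n => (1 / ((n : ℝ) + 1)) ^ q⁻¹ with hb
  have hb0 : Filter.Tendsto b Filter.atTop (nhds 0) := by
    have h1 := (tendsto_one_div_add_atTop_nhds_zero_nat (𝕜 := ℝ)).rpow_const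
      (p := q⁻¹) (Or.inr (inv_pos.2 hq).le)
    rwa [Real.zero_rpow (inv_pos.2 hq).ne'] at h1
  have key : ∀ n, ∀ a ∈ D, partialSups d n ≤ a → ‖a - partialSups d n‖ ≤ b n := by
    intro n a ha hna
    have h1 := hs.norm_sub_rpow_le (hD _ (he n)).1 hna
    have h2 : ‖d n‖ ^ q ≤ ‖partialSups d n‖ ^ q :=
      Real.rpow_le_rpow (norm_nonneg _)
        (norm_le_norm_of_nonneg (hD _ (hd n)).1 (le_partialSups d n)) hq.le
    have h3 : ‖a - partialSups d n‖ ^ q ≤ 1 / ((n : ℝ) + 1) := by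
      linarith [hle a ha, hdc n]
    exact (Real.le_rpow_inv_iff_of_pos (norm_nonneg _) (by positivity) hq).2 h3
  have hcau : CauchySeq (fun n => partialSups d n) := by
    refine cauchySeq_of_le_tendsto_0' b (fun n m hnm => ?_) hb0
    rw [dist_comm, dist_eq_norm]
    exact key n _ (he m) ((partialSups d).monotone hnm)
  obtain ⟨x, hx⟩ := cauchySeq_tendsto_of_complete hcau
  refine ⟨x, mem_closure_of_tendsto hx (Filter.Eventually.of_forall he), fun a ha => ?_⟩
  -- `a ⊔ partialSups d n` is again in `D`, so `key` bounds its excess; in the limit `a ⊔ x = x`.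
  have h1 : Filter.Tendsto (fun n => a ⊔ partialSups d n - partialSups d n) Filter.atTop
      (nhds 0) :=
    squeeze_zero_norm (fun n => key n _ (hsup _ ha _ (he n)) le_sup_right) hb0
  have h2 : Filter.Tendsto (fun n => a ⊔ partialSups d n - partialSups d n) Filter.atTop
      (nhds (a ⊔ x - x)) := (Filter.Tendsto.sup_nhds tendsto_const_nhds hx).sub hx
  have h3 := tendsto_nhds_unique h2 h1
  exact sup_eq_right.1 (sub_eq_zero.1 h3)

/-- The Archimedean property, read off from the norm: `n * ‖t‖ ≤ ‖v‖` for all `n`. -/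
lemma eq_zero_of_forall_nsmul_le {t v : E} (ht : 0 ≤ t) (h : ∀ n : ℕ, n • t ≤ v)
    (hn : ∀ n : ℕ, ‖n • t‖ = n * ‖t‖) : t = 0 := by
  by_contra hne
  have hpos : 0 < ‖t‖ := norm_pos_iff.2 hne
  obtain ⟨n, hlt⟩ := exists_nat_gt (‖v‖ / ‖t‖)
  rw [div_lt_iff₀ hpos, ← hn] at hlt
  exact absurd (norm_le_norm_of_nonneg (nsmul_nonneg ht n) (h n)) (not_le.2 hlt)

/-- Projection of a positive element onto the band generated by a solid cone. -/
lemma IsSolidCone.exists_projection [NormedSpace ℝ E] (hs : NormSuperadditive E q) (hq : 0 < q)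
    {S : Set E} (hS : IsSolidCone S) {v : E} (hv : 0 ≤ v) :
    ∃ x ∈ closure {s ∈ S | s ≤ v}, 0 ≤ x ∧ x ≤ v ∧ ∀ s ∈ S, (v - x) ⊓ s = 0 := by
  obtain ⟨x, hx, hub⟩ := hs.exists_upperBound_mem_closure hq (D := {s ∈ S | s ≤ v}) (u := v)
    ⟨0, hS.zero_mem, hv⟩ (fun a ha b hb => ⟨hS.sup_mem ha.1 hb.1, sup_le ha.2 hb.2⟩)
    (fun d hd => ⟨hS.nonneg d hd.1, hd.2⟩)
  have hxv : x ≤ v := by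
    have : closure {s ∈ S | s ≤ v} ⊆ Set.Iic v :=
      closure_minimal (fun s hs => hs.2) isClosed_Iic
    exact this hx
  refine ⟨x, hx, hub 0 ⟨hS.zero_mem, hv⟩, hxv, fun s hsS => ?_⟩
  have ht0 : 0 ≤ (v - x) ⊓ s := le_inf (sub_nonneg.2 hxv) (hS.nonneg s hsS)
  have htS : (v - x) ⊓ s ∈ S := hS.mem_of_le s hsS _ ht0 inf_le_right
  -- For `t = (v - x) ⊓ s`: if `k • t ≤ v`, then `k • t` lies in the set bounded by `x`, and adding
  -- `t ≤ v - x` gives `(k + 1) • t ≤ v`.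
  refine eq_zero_of_forall_nsmul_le (v := v) ht0 (fun n => ?_) (fun n => ?_)
  · induction n with
    | zero => rwa [zero_nsmul]
    | succ k ih =>
      have h1 : k • ((v - x) ⊓ s) ≤ x := hub _ ⟨hS.nsmul_mem htS k, ih⟩
      rw [succ_nsmul]
      calc k • ((v - x) ⊓ s) + (v - x) ⊓ s ≤ x + (v - x) := add_le_add h1 inf_le_left
        _ = v := by abel
  · rw [← Nat.cast_smul_eq_nsmul ℝ, norm_smul, Real.norm_natCast]

end SuperadditiveNorm

/-! ### Lattice automorphisms and maximal disjoint cones -/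

section Automorphism

variable {E : Type*} [NormedAddCommGroup E] [NormedSpace ℝ E] [Lattice E]

lemma map_inf_of_mem {T : E ≃ₗᵢ[ℝ] E} (hT : T ∈ latticeAut E) (x y : E) :
    T (x ⊓ y) = T x ⊓ T y := (hT x y).2

lemma map_le_map_iff {T : E ≃ₗᵢ[ℝ] E} (hT : T ∈ latticeAut E) {x y : E} :
    T x ≤ T y ↔ x ≤ y := by
  rw [← inf_eq_left, ← map_inf_of_mem hT, T.injective.eq_iff, inf_eq_left]

lemma map_nonneg_iff {T : E ≃ₗᵢ[ℝ] E} (hT : T ∈ latticeAut E) {x : E} : 0 ≤ T x ↔ 0 ≤ x := by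
  conv_lhs => rw [← map_zero T]
  exact map_le_map_iff hT

lemma symm_nonneg_iff {T : E ≃ₗᵢ[ℝ] E} (hT : T ∈ latticeAut E) {x : E} :
    0 ≤ T.symm x ↔ 0 ≤ x := by
  rw [← map_nonneg_iff hT, T.apply_symm_apply]

lemma inf_map_eq_zero_iff {T : E ≃ₗᵢ[ℝ] E} (hT : T ∈ latticeAut E) {x y : E} :
    T x ⊓ T y = 0 ↔ x ⊓ y = 0 := by
  rw [← map_inf_of_mem hT, map_eq_zero_iff T T.injective]

variable [IsOrderedAddMonoid E]

lemma IsSolidCone.preimage {T : E ≃ₗᵢ[ℝ] E} (hT : T ∈ latticeAut E) {S : Set E}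
    (hS : IsSolidCone S) : IsSolidCone {x | T x ∈ S} where
  zero_mem := by simpa using hS.zero_mem
  nonneg s hs := (map_nonneg_iff hT).1 (hS.nonneg _ hs)
  add_mem s hs t ht := by
    change T (s + t) ∈ S
    rw [map_add]; exact hS.add_mem _ hs _ ht
  mem_of_le s hs t ht hts :=
    hS.mem_of_le _ hs _ ((map_nonneg_iff hT).2 ht) ((map_le_map_iff hT).2 hts)

lemma symm_mem {T : E ≃ₗᵢ[ℝ] E} (hT : T ∈ latticeAut E) : T.symm ∈ latticeAut E :=
  (latticeAut E).inv_mem hT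

/-- There is a maximal solid cone that is disjoint from its image under a given automorphism. -/
lemma exists_maximal_disjoint_cone {T : E ≃ₗᵢ[ℝ] E} (hT : T ∈ latticeAut E) :
    ∃ S : Set E, IsSolidCone S ∧ (∀ x ∈ S, ∀ y ∈ S, x ⊓ T y = 0) ∧
      ∀ z, 0 ≤ z → z ⊓ T z = 0 → (∀ s ∈ S, z ⊓ T s = 0) → (∀ s ∈ S, s ⊓ T z = 0) → z ∈ S := by
  -- Zorn is applied to plain sets of positive elements; that a maximal one is a solid cone follows
  -- from the membership criterion `hmem`.
  obtain ⟨S, hS⟩ : ∃ S, Maximal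
      (fun S => S ∈ {S : Set E | (∀ x ∈ S, 0 ≤ x) ∧ ∀ x ∈ S, ∀ y ∈ S, x ⊓ T y = 0}) S := by
    refine zorn_subset _ fun c hc hchain => ⟨⋃₀ c, ⟨?_, ?_⟩, fun s hs =>
      Set.subset_sUnion_of_mem hs⟩
    · rintro x ⟨A, hA, hx⟩
      exact (hc hA).1 x hx
    · rintro x ⟨A, hA, hx⟩ y ⟨B, hB, hy⟩
      rcases hchain.total hA hB with h | h
      · exact (hc hB).2 x (h hx) y hy
      · exact (hc hA).2 x hx y (h hy)
  obtain ⟨⟨hpos, hdis⟩, hmax⟩ := hS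
  have hmem : ∀ z, 0 ≤ z → z ⊓ T z = 0 → (∀ s ∈ S, z ⊓ T s = 0) → (∀ s ∈ S, s ⊓ T z = 0) →
      z ∈ S := by
    intro z hz hzz h1 h2
    refine hmax (y := insert z S) ⟨?_, ?_⟩ (Set.subset_insert z S) (Set.mem_insert z S)
    · rintro x (rfl | hx)
      exacts [hz, hpos x hx]
    · rintro x (rfl | hx) y (rfl | hy)
      exacts [hzz, h1 y hy, h2 x hx, hdis x hx y hy]
  have hTpos : ∀ x, 0 ≤ x → 0 ≤ T x := fun x => (map_nonneg_iff hT).2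
  refine ⟨S, ⟨?_, hpos, ?_, ?_⟩, hdis, hmem⟩
  · refine hmem 0 le_rfl (by simp) (fun s hs => ?_) (fun s hs => ?_)
    · exact inf_eq_left.2 (hTpos _ (hpos s hs))
    · rw [map_zero]; exact inf_eq_right.2 (hpos s hs)
  · intro s hs t ht
    have hs0 := hpos s hs
    have ht0 := hpos t ht
    have right : ∀ r ∈ S, r ⊓ T (s + t) = 0 := fun r hr => by
      rw [map_add]
      exact inf_add_eq_zero (hpos r hr) (hTpos _ hs0) (hTpos _ ht0) (hdis r hr s hs)
        (hdis r hr t ht)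
    have left : ∀ y, 0 ≤ y → s ⊓ y = 0 → t ⊓ y = 0 → (s + t) ⊓ y = 0 := fun y hy h1 h2 => by
      rw [inf_comm] at h1 h2 ⊢
      exact inf_add_eq_zero hy hs0 ht0 h1 h2
    exact hmem _ (add_nonneg hs0 ht0)
      (left _ (hTpos _ (add_nonneg hs0 ht0)) (right s hs) (right t ht))
      (fun r hr => left _ (hTpos _ (hpos r hr)) (hdis s hs r hr) (hdis t ht r hr)) right
  · intro s hs t ht hts
    have hTts := (map_le_map_iff hT).2 hts
    exact hmem t ht (inf_eq_zero_of_le ht (hTpos _ ht) hts hTts (hdis s hs s hs))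
      (fun r hr => inf_eq_zero_of_le ht (hTpos _ (hpos r hr)) hts le_rfl (hdis s hs r hr))
      (fun r hr => inf_eq_zero_of_le (hpos r hr) (hTpos _ ht) le_rfl hTts (hdis r hr s hs))

/-! ### Disjoint thirds, and the converse from approximate witnesses -/

variable [HasSolidNorm E] [CompleteSpace E] {q : ℝ}

lemma inf_eq_zero_of_mem_closure {D : Set E} {x y : E} (hx : x ∈ closure D)
    (h : ∀ d ∈ D, y ⊓ d = 0) : y ⊓ x = 0 := by
  have hc : IsClosed {d : E | y ⊓ d = 0} :=
    isClosed_eq (continuous_const.inf continuous_id) continuous_const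
  exact (closure_minimal h hc : closure D ⊆ {d : E | y ⊓ d = 0}) hx

/-- If every nonzero positive element has a nonzero positive element in its band that is disjoint
from its image, then every positive element dominates one that is disjoint from its image and has
at least a third of the norm, up to an arbitrarily small error. -/
lemma exists_disjoint_third (hs : NormSuperadditive E q) (hq : 0 < q) {T : E ≃ₗᵢ[ℝ] E}
    (hT : T ∈ latticeAut E)
    (hfree : ∀ z : E, 0 < z → ∃ v, 0 < v ∧ (∀ y, 0 ≤ y → z ⊓ y = 0 → v ⊓ y = 0) ∧ v ⊓ T v = 0)
    {u : E} (hu : 0 ≤ u) {ε : ℝ} (hε : 0 < ε) :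
    ∃ v, 0 ≤ v ∧ v ≤ u ∧ v ⊓ T v = 0 ∧ (1 / 3 : ℝ) * ‖u‖ - ε ≤ ‖v‖ := by
  obtain ⟨S, hS, hdis, hmem⟩ := exists_maximal_disjoint_cone hT
  have hB : IsSolidCone {x | T x ∈ S} := hS.preimage hT
  have hC : IsSolidCone {x | T.symm x ∈ S} := hS.preimage (symm_mem hT)
  have hTpos : ∀ x, 0 ≤ x → 0 ≤ T x := fun x => (map_nonneg_iff hT).2
  have hTspos : ∀ x, 0 ≤ x → 0 ≤ T.symm x := fun x => (symm_nonneg_iff hT).2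
  obtain ⟨x, hx, hx0, hxu, hperp⟩ :=
    (isSolidCone_add_three hS hB hC).exists_projection hs hq hu
  -- The residue `u - x` is disjoint from all three cones; were it nonzero, freeness would
  -- contradict maximality of `S`.
  have hxu' : x = u := by
    by_contra hne
    have hz : 0 < u - x := lt_of_le_of_ne (sub_nonneg.2 hxu)
      (fun h => hne (sub_eq_zero.1 h.symm).symm)
    obtain ⟨v, hv, hvband, hvT⟩ := hfree _ hz
    have h1 : ∀ s ∈ S, v ⊓ s = 0 := fun s hsS => hvband _ (hS.nonneg s hsS)
      (hperp s ⟨hS.nonneg s hsS, s, hsS, 0, hB.zero_mem, 0, hC.zero_mem, by simp⟩)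
    have h2 : ∀ s ∈ S, v ⊓ T s = 0 := fun s hsS => hvband _ (hTpos _ (hS.nonneg s hsS))
      (hperp _ ⟨hTpos _ (hS.nonneg s hsS), 0, hS.zero_mem, 0, hB.zero_mem, T s,
        by simpa using hsS, by simp⟩)
    have h3 : ∀ s ∈ S, s ⊓ T v = 0 := fun s hsS => by
      have h4 := hvband _ (hTspos _ (hS.nonneg s hsS))
        (hperp _ ⟨hTspos _ (hS.nonneg s hsS), 0, hS.zero_mem, T.symm s,
          by simpa using hsS, 0, hC.zero_mem, by simp⟩)
      rw [← inf_map_eq_zero_iff hT, T.apply_symm_apply] at h4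
      rw [inf_comm, h4]
    have h5 := h1 v (hmem v hv.le hvT h2 h3)
    rw [inf_idem] at h5
    exact hv.ne' h5
  rw [hxu'] at hx
  obtain ⟨t, ⟨⟨ht0, a, ha, b, hb, c, hc, hle⟩, htu⟩, hdist⟩ := Metric.mem_closure_iff.1 hx ε hε
  have ha0 := hS.nonneg a ha
  have hb0 := hB.nonneg b hb
  have hc0 := hC.nonneg c hc
  have hsum : t ≤ t ⊓ a + t ⊓ b + t ⊓ c := by
    refine (le_inf_add_inf ht0 (add_nonneg ha0 hb0) hc0 hle).trans ?_
    gcongr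
    exact inf_add_le_inf_add_inf ht0 ha0 hb0
  have hnorm : ‖t‖ ≤ ‖t ⊓ a‖ + ‖t ⊓ b‖ + ‖t ⊓ c‖ :=
    (norm_le_norm_of_nonneg ht0 hsum).trans (norm_add₃_le)
  have hnu : ‖u‖ ≤ ‖t‖ + ε := by
    rw [dist_eq_norm] at hdist
    linarith [norm_sub_norm_le u t]
  have main : ∀ s, 0 ≤ s → s ⊓ T s = 0 → (1 / 3 : ℝ) * ‖u‖ - ε ≤ ‖t ⊓ s‖ →
      ∃ v, 0 ≤ v ∧ v ≤ u ∧ v ⊓ T v = 0 ∧ (1 / 3 : ℝ) * ‖u‖ - ε ≤ ‖v‖ := fun s hs0 hsT hn =>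
    ⟨t ⊓ s, le_inf ht0 hs0, inf_le_left.trans htu,
      inf_eq_zero_of_le (le_inf ht0 hs0) (hTpos _ (le_inf ht0 hs0)) inf_le_right
        ((map_le_map_iff hT).2 inf_le_right) hsT, hn⟩
  by_cases h1 : (1 / 3 : ℝ) * ‖u‖ - ε ≤ ‖t ⊓ a‖
  · exact main a ha0 (hdis a ha a ha) h1
  by_cases h2 : (1 / 3 : ℝ) * ‖u‖ - ε ≤ ‖t ⊓ b‖
  · exact main b hb0 ((inf_map_eq_zero_iff hT).1 (hdis _ hb _ hb)) h2
  refine main c hc0 ?_ (by linarith)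
  rw [← T.apply_symm_apply c, inf_map_eq_zero_iff hT]
  exact hdis _ hc _ hc

/-- If no nonzero element of `[0, u]` is disjoint from its image under an automorphism, then the
automorphism preserves disjointness from elements of `[0, u]`. -/
lemma inf_map_eq_zero_of_no_disjoint {T : E ≃ₗᵢ[ℝ] E} (hT : T ∈ latticeAut E) {u : E}
    (hno : ∀ v, 0 ≤ v → v ≤ u → v ⊓ T v = 0 → v = 0) {v y : E} (hv : 0 ≤ v) (hvu : v ≤ u)
    (hy : 0 ≤ y) (hyv : y ⊓ v = 0) : y ⊓ T v = 0 := by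
  have ht : 0 ≤ y ⊓ T v := le_inf hy ((map_nonneg_iff hT).2 hv)
  have hs0 : 0 ≤ T.symm (y ⊓ T v) := (symm_nonneg_iff hT).2 ht
  have hsv : T.symm (y ⊓ T v) ≤ v := by
    rw [← map_le_map_iff hT, T.apply_symm_apply]
    exact inf_le_right
  -- The preimage of `y ⊓ T v` lies below `v` and its image lies below `y`, so it is disjoint from
  -- its own image.
  have h := hno _ hs0 (hsv.trans hvu) (by
    rw [T.apply_symm_apply, inf_comm]
    exact inf_eq_zero_of_le ht hs0 inf_le_left hsv hyv)
  rwa [map_eq_zero_iff T.symm T.symm.injective] at h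

/-- If no nonzero element of `[0, u]` is disjoint from its image under an automorphism, then the
automorphism does not decrease any element of `[0, u]`. -/
lemma le_map_of_no_disjoint (hs : NormSuperadditive E q) (hq : 0 < q) {T : E ≃ₗᵢ[ℝ] E}
    (hT : T ∈ latticeAut E) {u : E} (hno : ∀ v, 0 ≤ v → v ≤ u → v ⊓ T v = 0 → v = 0) {v : E}
    (hv : 0 ≤ v) (hvu : v ≤ u) : v ≤ T v := by
  have band : ∀ {v y : E}, 0 ≤ v → v ≤ u → 0 ≤ y → y ⊓ v = 0 → y ⊓ T v = 0 :=
    fun h1 h2 h3 h4 => inf_map_eq_zero_of_no_disjoint hT hno h1 h2 h3 h4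
  have hz : 0 ≤ (v - T v)⁺ := posPart_nonneg _
  have hn : 0 ≤ (v - T v)⁻ := negPart_nonneg _
  obtain ⟨x, hx, hx0, hxv, hperp⟩ := (isSolidCone_principal (v - T v)⁺).exists_projection hs hq hv
  have hr0 : 0 ≤ v - x := sub_nonneg.2 hxv
  have hrz : (v - x) ⊓ (v - T v)⁺ = 0 := hperp _ ⟨hz, 1, by simp⟩
  have hrx : (v - x) ⊓ x = 0 := inf_eq_zero_of_mem_closure hx fun d hd => hperp d hd.1
  have hnx : (v - T v)⁻ ⊓ x = 0 := by
    refine inf_eq_zero_of_mem_closure hx ?_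
    rintro d ⟨⟨hd0, n, hdn⟩, -⟩
    refine inf_eq_zero_of_le hn hd0 le_rfl hdn (inf_nsmul_eq_zero hn hz ?_ n)
    rw [inf_comm]
    exact posPart_inf_negPart_eq_zero _
  have hTx0 : 0 ≤ T x := (map_nonneg_iff hT).2 hx0
  have hTr0 : 0 ≤ T (v - x) := (map_nonneg_iff hT).2 hr0
  -- `(T x - x)⁺` is at most `(v - T v)⁻ + (v - x)`. Both summands are disjoint from `x`, hence from
  -- `T x`, hence from `(T x - x)⁺ ≤ T x`.
  have hTx : T x ≤ x := by
    have hq0 : 0 ≤ (T x - x)⁺ := posPart_nonneg _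
    have hqT : (T x - x)⁺ ≤ T x := sup_le (sub_le_self _ hx0) hTx0
    have hq1 : (T x - x)⁺ ≤ (v - T v)⁻ + (v - x) := by
      refine sup_le ?_ (add_nonneg hn hr0)
      have h1 : T v - v ≤ (v - T v)⁻ := by
        rw [← neg_sub]; exact neg_le_negPart _
      have h2 : T x - x ≤ (T v - v) + (v - x) := by
        rw [sub_add_sub_cancel]
        exact sub_le_sub_right ((map_le_map_iff hT).2 hxv) _
      exact h2.trans (add_le_add_left h1 _)
    have h3 : (T x - x)⁺ ⊓ (v - T v)⁻ = 0 := by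
      rw [inf_comm]
      exact inf_eq_zero_of_le hn hq0 le_rfl hqT (band hx0 (hxv.trans hvu) hn hnx)
    have h4 : (T x - x)⁺ ⊓ (v - x) = 0 := by
      rw [inf_comm]
      exact inf_eq_zero_of_le hr0 hq0 le_rfl hqT (band hx0 (hxv.trans hvu) hr0 hrx)
    have h5 := inf_add_eq_zero hq0 hn hr0 h3 h4
    rw [inf_eq_left.2 hq1] at h5
    exact sub_nonpos.1 (posPart_eq_zero.1 h5)
  have hTxx : T x = x := hs.eq_of_le_of_norm_eq hq hTx0 hTx (T.norm_map x)
  -- Since `T` fixes `x`, the excess of `v` over `T v` sits inside `v - x`, from which it is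
  -- disjoint.
  have hzr : (v - T v)⁺ ≤ v - x := by
    refine sup_le ?_ hr0
    calc v - T v = (v - x) - T (v - x) := by rw [map_sub, hTxx]; abel
      _ ≤ v - x := sub_le_self _ hTr0
  rw [inf_eq_right.2 hzr] at hrz
  exact sub_nonpos.1 (posPart_eq_zero.1 hrz)

/-- Approximately disjoint witnesses below `u` give a nonzero element of `[0, u]` disjoint from
its image. -/
lemma exists_disjoint_of_approx (hs : NormSuperadditive E q) (hq : 0 < q) {T : E ≃ₗᵢ[ℝ] E}
    (hT : T ∈ latticeAut E) {u : E} (hu : 0 < u)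
    (happ : ∀ ε : ℝ, 0 < ε → ∃ v w : E, 0 ≤ v ∧ 0 ≤ w ∧ v ≤ u + w ∧ ‖w‖ ≤ ε ∧
      ‖v ⊓ T v‖ ≤ ε ∧ (1 / 3 : ℝ) * ‖u‖ - ε ≤ ‖v‖) :
    ∃ v, 0 < v ∧ v ≤ u ∧ v ⊓ T v = 0 := by
  by_contra! hcon
  have hno : ∀ v, 0 ≤ v → v ≤ u → v ⊓ T v = 0 → v = 0 := by
    intro v hv hvu hvT
    by_contra hne
    exact hcon v (lt_of_le_of_ne hv (Ne.symm hne)) hvu hvT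
  have hpos : 0 < ‖u‖ := norm_pos_iff.2 hu.ne'
  -- The estimates give `‖u‖ / 3 - ε ≤ ‖v‖ ≤ 2 * ε`, so any `ε < ‖u‖ / 9` yields a contradiction.
  obtain ⟨v, w, hv, hw, hvuw, hwn, hvT, hvn⟩ := happ (‖u‖ / 10) (by positivity)
  have hm0 : 0 ≤ v ⊓ u := le_inf hv hu.le
  have hm : v ⊓ u ≤ v ⊓ T v :=
    le_inf inf_le_left ((le_map_of_no_disjoint hs hq hT hno hm0 inf_le_right).trans
      ((map_le_map_iff hT).2 inf_le_left))
  have hvle : v ≤ v ⊓ u + w :=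
    (le_inf_add_inf hv hu.le hw hvuw).trans (by gcongr; exact inf_le_right)
  have h1 := norm_le_norm_of_nonneg hm0 hm
  have h2 := (norm_le_norm_of_nonneg hv hvle).trans (norm_add_le _ _)
  linarith

lemma AreDisjoint.inf_eq_zero {x y : E} (h : AreDisjoint x y) (hx : 0 ≤ x) (hy : 0 ≤ y) :
    x ⊓ y = 0 := by
  rwa [AreDisjoint, abs_of_nonneg hx, abs_of_nonneg hy] at h

/-- The one consequence of band membership that the forward direction needs. -/
lemma inf_eq_zero_of_mem_band {u v y : E} (hu : 0 ≤ u) (hv : 0 ≤ v) (hvu : v ∈ band u)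
    (hy : 0 ≤ y) (huy : u ⊓ y = 0) : v ⊓ y = 0 := by
  refine AreDisjoint.inf_eq_zero (hvu y ?_) hv hy
  rintro _ rfl
  rw [AreDisjoint, abs_of_nonneg hu, abs_of_nonneg hy, inf_comm, huy]

lemma mem_band_of_le {u v : E} (hv : 0 ≤ v) (hvu : v ≤ u) : v ∈ band u := by
  intro y hy
  have h : |y| ⊓ |u| = 0 := hy u rfl
  rw [abs_of_nonneg (hv.trans hvu)] at h
  rw [AreDisjoint, abs_of_nonneg hv, inf_comm]
  exact inf_eq_zero_of_le (abs_nonneg y) hv le_rfl hvu h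

/-! ### Group actions and the continuous sentence -/

variable {G : Type*} [Group G] {ρ : G →* latticeAut E}

lemma FunctionallyFree.exists_disjoint_third (h : FunctionallyFree ρ)
    (hs : NormSuperadditive E q) (hq : 0 < q) {g : G} (hg : g ≠ 1) {u : E} (hu : 0 ≤ u) {ε : ℝ}
    (hε : 0 < ε) :
    ∃ v, 0 ≤ v ∧ v ≤ u ∧ v ⊓ (ρ g : E ≃ₗᵢ[ℝ] E) v = 0 ∧ (1 / 3 : ℝ) * ‖u‖ - ε ≤ ‖v‖ := by
  refine GLp.exists_disjoint_third hs hq (ρ g).2 (fun z hz => ?_) hu hε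
  obtain ⟨v, hvz, hv, hd⟩ := h g hg z hz
  exact ⟨v, hv, fun y hy hzy => inf_eq_zero_of_mem_band hz.le hv.le hvz hy hzy,
    hd.inf_eq_zero hv.le ((map_nonneg_iff (ρ g).2).2 hv.le)⟩

/-- It suffices to verify the approximate condition on the positive part of the unit ball. -/
lemma functionallyFree_of_approx (hsmul : ∀ (c : ℝ) (x : E), 0 ≤ c → 0 ≤ x → 0 ≤ c • x)
    (hs : NormSuperadditive E q) (hq : 0 < q)
    (happ : ∀ g : G, g ≠ 1 → ∀ u : E, 0 ≤ u → ‖u‖ ≤ 1 → ∀ ε : ℝ, 0 < ε →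
      ∃ v w : E, 0 ≤ v ∧ 0 ≤ w ∧ v ≤ u + w ∧ ‖w‖ ≤ ε ∧
        ‖v ⊓ (ρ g : E ≃ₗᵢ[ℝ] E) v‖ ≤ ε ∧ (1 / 3 : ℝ) * ‖u‖ - ε ≤ ‖v‖) :
    FunctionallyFree ρ := by
  intro g hg u hu
  -- Scaling brings `u` into the unit ball, and `c ≤ 1` keeps everything below `c • u` in the band
  -- of `u`.
  set c : ℝ := (1 + ‖u‖)⁻¹ with hc
  have hc0 : 0 < c := by positivity
  have hc1 : c ≤ 1 := inv_le_one_of_one_le₀ (by linarith [norm_nonneg u])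
  have hcu0 : 0 ≤ c • u := hsmul c u hc0.le hu.le
  have hcu : c • u ≤ u := by
    have h1 := hsmul (1 - c) u (sub_nonneg.2 hc1) hu.le
    rw [sub_smul, one_smul] at h1
    exact sub_nonneg.1 h1
  have hcpos : 0 < c • u := lt_of_le_of_ne hcu0 (Ne.symm (smul_ne_zero hc0.ne' hu.ne'))
  have hcn : ‖c • u‖ ≤ 1 := by
    rw [norm_smul, Real.norm_of_nonneg hc0.le, hc, inv_mul_le_iff₀ (by positivity)]
    linarith
  obtain ⟨v, hv, hvu, hvT⟩ := exists_disjoint_of_approx hs hq (ρ g).2 hcpos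
    (fun ε hε => happ g hg _ hcu0 hcn ε hε)
  refine ⟨v, mem_band_of_le hv.le (hvu.trans hcu), hv, ?_⟩
  rwa [AreDisjoint, abs_of_nonneg hv.le, abs_of_nonneg ((map_nonneg_iff (ρ g).2).2 hv.le)]

/-- The value of the sentence is zero exactly when the matrix can be made arbitrarily small. -/
lemma freenessSentence_eq_zero_iff (g : G) :
    freenessSentence ρ g = 0 ↔ ∀ x : E, ‖x‖ ≤ 1 → ∀ ε : ℝ, 0 < ε → ∃ y : E, ‖y‖ ≤ 1 ∧
      ‖(|x| - |y|)⁻‖ < ε ∧ ‖(ρ g : E ≃ₗᵢ[ℝ] E) |y| ⊓ |y|‖ < ε ∧ ‖x‖ / 3 - ‖y‖ < ε := by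
  set F : Metric.closedBall (0 : E) 1 → Metric.closedBall (0 : E) 1 → ℝ := fun x y =>
    max (max ‖(|(x : E)| - |(y : E)|)⁻‖ ‖(ρ g : E ≃ₗᵢ[ℝ] E) |(y : E)| ⊓ |(y : E)|‖)
      (‖(x : E)‖ / 3 - ‖(y : E)‖) with hF
  have hdef : freenessSentence ρ g = ⨆ x, ⨅ y, F x y := rfl
  have : Nonempty (Metric.closedBall (0 : E) 1) := ⟨⟨0, by simp⟩⟩
  have hF0 : ∀ x y, 0 ≤ F x y := fun x y =>
    (norm_nonneg _).trans ((le_max_left _ _).trans (le_max_left _ _))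
  have hbelow : ∀ x, BddBelow (Set.range (F x)) := fun x =>
    ⟨0, by rintro _ ⟨y, rfl⟩; exact hF0 x y⟩
  have hinf0 : ∀ x, 0 ≤ ⨅ y, F x y := fun x => le_ciInf (hF0 x)
  -- An unbounded real supremum would default to `0`, so a bound is needed; `y = 0` gives `‖x‖ / 3 ≤
  -- 1`.
  have habove : BddAbove (Set.range fun x => ⨅ y, F x y) := by
    refine ⟨1, ?_⟩
    rintro _ ⟨x, rfl⟩
    refine (ciInf_le (hbelow x) ⟨0, by simp⟩).trans ?_
    have hx : ‖(x : E)‖ ≤ 1 := mem_closedBall_zero_iff.1 x.2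
    have h1 : (|(x : E)|)⁻ = 0 := negPart_eq_zero.2 (abs_nonneg _)
    simp only [hF, abs_zero, sub_zero, h1, map_zero, inf_idem, norm_zero, max_self]
    exact max_le zero_le_one (by linarith)
  rw [hdef]
  constructor
  · intro h x hx ε hε
    have h1 : ⨅ y, F ⟨x, mem_closedBall_zero_iff.2 hx⟩ y < ε :=
      ((le_ciSup habove _).trans h.le).trans_lt hε
    obtain ⟨y, hy⟩ := exists_lt_of_ciInf_lt h1
    obtain ⟨h2, h3⟩ := max_lt_iff.1 hy
    obtain ⟨h4, h5⟩ := max_lt_iff.1 h2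
    exact ⟨y, mem_closedBall_zero_iff.1 y.2, h4, h5, h3⟩
  · intro h
    have h0 : ∀ x, ⨅ y, F x y = 0 := by
      intro x
      refine le_antisymm (le_of_forall_pos_le_add fun ε hε => ?_) (hinf0 x)
      obtain ⟨y, hy, h1, h2, h3⟩ := h x (mem_closedBall_zero_iff.1 x.2) ε hε
      rw [zero_add]
      exact (ciInf_le (hbelow x) ⟨y, mem_closedBall_zero_iff.2 hy⟩).trans
        (max_lt (max_lt h1 h2) h3).le
    simp [h0]

end Automorphism

/-! ### Transfer from concrete `L^p` spaces -/

section LpTransfer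

/-- The `L^p` norm is `p`-superadditive on the positive cone. -/
lemma normSuperadditive_Lp {X : Type*} [MeasurableSpace X] (μ : Measure X) (p : ℝ≥0∞)
    [Fact (1 ≤ p)] (hp : p ≠ ∞) : NormSuperadditive (Lp ℝ p μ) p.toReal := by
  have h1p : 1 ≤ p := Fact.out
  have hp0 : p ≠ 0 := (zero_lt_one.trans_le h1p).ne'
  have hr1 : 1 ≤ p.toReal := by
    rw [← ENNReal.toReal_one]; exact (ENNReal.toReal_le_toReal ENNReal.one_ne_top hp).2 h1p
  have hr0 : 0 < p.toReal := zero_lt_one.trans_le hr1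
  have hpow : ∀ f : Lp ℝ p μ, ‖f‖ ^ p.toReal = (∫⁻ x, ‖f x‖ₑ ^ p.toReal ∂μ).toReal := fun f => by
    rw [Lp.norm_def, eLpNorm_eq_lintegral_rpow_enorm_toReal hp0 hp, ENNReal.toReal_rpow,
      ← ENNReal.rpow_mul, one_div, inv_mul_cancel₀ hr0.ne', ENNReal.rpow_one]
  have hfin : ∀ f : Lp ℝ p μ, ∫⁻ x, ‖f x‖ₑ ^ p.toReal ∂μ ≠ ∞ := fun f =>
    (lintegral_rpow_enorm_lt_top_of_eLpNorm_lt_top hp0 hp (Lp.eLpNorm_lt_top f)).ne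
  intro a b ha hb
  rw [hpow, hpow, hpow, ← ENNReal.toReal_add (hfin a) (hfin b)]
  refine ENNReal.toReal_mono (hfin _) ?_
  rw [← lintegral_add_left' ((Lp.aestronglyMeasurable a).enorm.pow_const _)]
  refine lintegral_mono_ae ?_
  filter_upwards [(Lp.coeFn_nonneg a).2 ha, (Lp.coeFn_nonneg b).2 hb, Lp.coeFn_add a b]
    with x hax hbx hab
  rw [hab, Pi.add_apply]
  have hax' : (0 : ℝ) ≤ a x := hax
  have hbx' : (0 : ℝ) ≤ b x := hbx
  rw [Real.enorm_of_nonneg hax', Real.enorm_of_nonneg hbx',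
    Real.enorm_of_nonneg (add_nonneg hax' hbx'), ENNReal.ofReal_add hax' hbx']
  -- Pointwise, `a ^ p + b ^ p ≤ (a + b) ^ p` for nonnegative values; this needs `1 ≤ p`.
  exact ENNReal.add_rpow_le_rpow_add _ _ hr1

lemma smul_nonneg_Lp {X : Type*} [MeasurableSpace X] {μ : Measure X} {p : ℝ≥0∞} {c : ℝ}
    {f : Lp ℝ p μ} (hc : 0 ≤ c) (hf : 0 ≤ f) : 0 ≤ c • f := by
  rw [← Lp.coeFn_nonneg] at hf ⊢
  filter_upwards [hf, Lp.coeFn_smul c f] with x hx hcx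
  rw [hcx]
  exact mul_nonneg hc hx

/-- The order and norm properties of an `L_p` lattice that the argument uses. -/
lemma IsLpLattice.properties {p : ℝ≥0∞} [Fact (1 ≤ p)] (hp : p ≠ ∞) {E : Type u}
    [NormedAddCommGroup E] [NormedSpace ℝ E] [Lattice E] (hE : IsLpLattice.{w, u} p E) :
    IsOrderedAddMonoid E ∧ HasSolidNorm E ∧ CompleteSpace E ∧ NormSuperadditive E p.toReal ∧
      ∀ (c : ℝ) (x : E), 0 ≤ c → 0 ≤ x → 0 ≤ c • x := by
  obtain ⟨X, _, μ, Φ, hΦ⟩ := hE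
  have hsup : ∀ x y, Φ (x ⊔ y) = Φ x ⊔ Φ y :=
    fun x y => map_sup (⟨Φ.toEquiv, hΦ _ _⟩ : E ≃o Lp ℝ p μ) x y
  have habs : ∀ x, Φ |x| = |Φ x| := fun x => by rw [abs, abs, hsup, map_neg]
  have hnn : ∀ x, 0 ≤ Φ x ↔ 0 ≤ x := fun x => by
    rw [← hΦ 0 x, map_zero]
  refine ⟨{ add_le_add_left := fun a b hab c => ?_ }, ⟨fun x y hxy => ?_⟩, ?_,
    fun a b ha hb => ?_, fun c x hc hx => ?_⟩
  · rw [← hΦ, map_add, map_add]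
    exact add_le_add_left ((hΦ a b).2 hab) _
  · rw [← hΦ, habs, habs] at hxy
    rw [← Φ.norm_map x, ← Φ.norm_map y]
    exact norm_le_norm_of_abs_le_abs hxy
  · exact (completeSpace_congr (e := Φ.toEquiv) Φ.isometry.isUniformEmbedding).2 inferInstance
  · rw [← Φ.norm_map a, ← Φ.norm_map b, ← Φ.norm_map (a + b), map_add]
    exact normSuperadditive_Lp μ p hp _ _ ((hnn a).2 ha) ((hnn b).2 hb)
  · rw [← hnn, map_smul]
    exact smul_nonneg_Lp hc ((hnn x).2 hx)

end LpTransfer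

end GLp

/-! ### The two equivalences -/

theorem theorem4p6 (G : Type v) [Group G] [Countable G] (hG : GLp.IsAmenable G)
    (p : ℝ≥0∞) [Fact (1 ≤ p)] (hp : p ≠ ∞)
    (E : Type u) [NormedAddCommGroup E] [NormedSpace ℝ E] [Lattice E]
    (hE : GLp.IsLpLattice.{w, u} p E) (ρ : G →* GLp.latticeAut E) :
    (GLp.FunctionallyFree ρ ↔
      ∀ g : G, g ≠ 1 → ∀ u : E, 0 ≤ u → ∀ ε : ℝ, 0 < ε →
        ∃ v w : E, 0 ≤ v ∧ 0 ≤ w ∧ v ≤ u + w ∧ ‖w‖ ≤ ε ∧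
          ‖v ⊓ (ρ g : E ≃ₗᵢ[ℝ] E) v‖ ≤ ε ∧ (1 / 3 : ℝ) * ‖u‖ - ε ≤ ‖v‖) ∧
    (GLp.FunctionallyFree ρ ↔ ∀ g : G, g ≠ 1 → GLp.freenessSentence ρ g = 0) := by
  obtain ⟨_, _, _, hs, hsmul⟩ := hE.properties hp
  have hq : 0 < p.toReal :=
    ENNReal.toReal_pos (zero_lt_one.trans_le (Fact.out : 1 ≤ p)).ne' hp
  refine ⟨⟨fun h g hg u hu ε hε => ?_, fun h => ?_⟩, ⟨fun h g hg => ?_, fun h => ?_⟩⟩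
  · obtain ⟨v, hv, hvu, hvT, hvn⟩ := h.exists_disjoint_third hs hq hg hu hε
    exact ⟨v, 0, hv, le_rfl, by rwa [add_zero], by rw [norm_zero]; exact hε.le,
      by rw [hvT, norm_zero]; exact hε.le, hvn⟩
  · exact GLp.functionallyFree_of_approx hsmul hs hq fun g hg u hu _ => h g hg u hu
  · rw [GLp.freenessSentence_eq_zero_iff]
    intro x hx ε hε
    obtain ⟨v, hv, hvu, hvT, hvn⟩ :=
      h.exists_disjoint_third hs hq hg (abs_nonneg x) (half_pos hε)
    have hvx := GLp.norm_le_norm_of_nonneg hv hvu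
    rw [norm_abs_eq_norm] at hvn hvx
    refine ⟨v, hvx.trans hx, ?_, ?_, by linarith⟩
    · rw [abs_of_nonneg hv, negPart_eq_zero.2 (sub_nonneg.2 hvu), norm_zero]
      exact hε
    · rw [abs_of_nonneg hv, inf_comm, hvT, norm_zero]
      exact hε
  · refine GLp.functionallyFree_of_approx hsmul hs hq fun g hg u hu hu1 ε hε => ?_
    obtain ⟨y, -, h1, h2, h3⟩ := (GLp.freenessSentence_eq_zero_iff g).1 (h g hg) u hu1 ε hε
    rw [abs_of_nonneg hu] at h1
    -- The error `w` is exactly the amount by which `|y|` exceeds `u`.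
    refine ⟨|y|, (u - |y|)⁻, abs_nonneg y, negPart_nonneg _, ?_, h1.le, ?_, ?_⟩
    · have h4 := neg_le_negPart (u - |y|)
      rw [neg_sub, sub_le_iff_le_add'] at h4
      exact h4
    · rw [inf_comm]; exact h2.le
    · rw [norm_abs_eq_norm]; linarith
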